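/- Let $R$ be a Noetherian local domain and let $I=P_1\cap\cdots\cap P_r$, where $P_1,\dots,P_r$ are prime ideals of $R$ of a common positive height such that each localization $R_{P_i}$ is a regular local ring. For $n\ge 0$ let $$I^{(n)}=\bigcap_{\mathfrak p\in\operatorname{Ass}(R/I)}\bigl(I^nR_{\mathfrak p}\cap R\bigr)$$ be the $n$-th symbolic power of $I$ (so $I^{(0)}=R$), and let $\mathcal I=\{I^{(n)}\}_{n\ge 0}$ be the symbolic filtration of $I$. For a filtration $\mathcal J=\{J_n\}_{n\ge0}$ of ideals on a local ring $(A,m_A)$ (that is, $A=J_0\supseteq J_1\supseteq\cdots$ and $J_iJ_j\subseteq J_{i+j}$ for all $i,j$), let $A[\mathcal J]=\bigoplus_{n\ge 0}J_nt^n\subseteq A[t]$ be its Rees algebra, and let the analytic spread of $\mathcal J$ be the Krull dimension $\ell(\mathcal J)=\dim A[\mathcal J]/m_AA[\mathcal J]$. For a prime ideal $Q$ of $R$ let $\mathcal I_Q=\{I^{(n)}R_Q\}_{n\ge 0}$, a filtration on $R_Q$. Then: 1. $\ell(\mathcal I_Q)<\operatorname{ht}(Q)$ for every prime ideal $Q$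 of $R$ which contains $I$ and is not one of $P_1,\dots,P_r$; 2. $\ell(\mathcal I_{P_i})=\operatorname{ht}(P_i)=\operatorname{ht}(I)$ for every $i=1,\dots,r$. -/

import Mathlib

/-- A filtration of ideals `R = I₀ ⊇ I₁ ⊇ I₂ ⊇ ⋯` with `Iᵢ Iⱼ ⊆ Iᵢ₊ⱼ`. -/
structure IdealFiltration (R : Type*) [CommRing R] where
  ideal : ℕ → Ideal R
  zero_eq_top : ideal 0 = ⊤
  antitone : Antitone ideal
  mul_le : ∀ i j, ideal i * ideal j ≤ ideal (i + j)

namespace IdealFiltration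

/-- The Rees algebra `R[𝓘] = ∑ₙ Iₙ tⁿ`, as a subalgebra of the polynomial ring `R[t]`. -/
def reesAlgebra {R : Type*} [CommRing R] (F : IdealFiltration R) : Subalgebra R (Polynomial R) where
  carrier := {f | ∀ n, f.coeff n ∈ F.ideal n}
  mul_mem' {f g} hf hg n := by
    rw [Polynomial.coeff_mul]
    refine Ideal.sum_mem _ fun p hp => ?_
    rw [← (Finset.HasAntidiagonal.mem_antidiagonal.mp hp : p.1 + p.2 = n)]
    exact F.mul_le _ _ (Ideal.mul_mem_mul (hf _) (hg _))
  add_mem' {f g} hf hg n := by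
    rw [Polynomial.coeff_add]
    exact Ideal.add_mem _ (hf n) (hg n)
  algebraMap_mem' r n := by
    rw [Polynomial.algebraMap_apply, Polynomial.coeff_C]
    split_ifs with h
    · rw [h, F.zero_eq_top]
      exact Submodule.mem_top
    · exact Ideal.zero_mem _

/-- The analytic spread `ℓ(𝓘) = dim R[𝓘] / m_R R[𝓘]` of a filtration on a local ring. -/
noncomputable def analyticSpread {R : Type*} [CommRing R] [IsLocalRing R]
    (F : IdealFiltration R) : WithBot ℕ∞ :=
  ringKrullDim (F.reesAlgebra ⧸
    (IsLocalRing.maximalIdeal R).map (algebraMap R F.reesAlgebra))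

/-- The filtration `{Iₙ S}` generated in an `R`-algebra `S`. -/
def extend {R : Type*} [CommRing R] (F : IdealFiltration R)
    (S : Type*) [CommRing S] [Algebra R S] : IdealFiltration S where
  ideal n := (F.ideal n).map (algebraMap R S)
  zero_eq_top := by rw [F.zero_eq_top, Ideal.map_top]
  antitone _ _ h := Ideal.map_mono (F.antitone h)
  mul_le i j := by
    rw [← Ideal.map_mul]
    exact Ideal.map_mono (F.mul_le i j)

/-- The localization `𝓘_Q = {Iₙ R_Q}` of a filtration at a prime ideal `Q`. -/
noncomputable def localization {R : Type*} [CommRing R] (F : IdealFiltration R)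
    (Q : Ideal R) [Q.IsPrime] : IdealFiltration (Localization.AtPrime Q) :=
  F.extend (Localization.AtPrime Q)

end IdealFiltration

/-- The symbolic power `I⁽ⁿ⁾ = ⋂_{p ∈ Ass(R/I)} (Iⁿ R_p ∩ R)`. -/
noncomputable def symbolicPower {R : Type*} [CommRing R] (I : Ideal R) (n : ℕ) : Ideal R :=
  ⨅ (p : PrimeSpectrum R) (_ : p.asIdeal ∈ associatedPrimes R (R ⧸ I)),
    ((I ^ n).map (algebraMap R (Localization.AtPrime p.asIdeal))).comap
      (algebraMap R (Localization.AtPrime p.asIdeal))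

/-- The symbolic filtration `{I⁽ⁿ⁾}` of an ideal `I` (with `I⁽⁰⁾ = R`). -/
noncomputable def symbolicFiltration {R : Type*} [CommRing R] (I : Ideal R) :
    IdealFiltration R where
  ideal := symbolicPower I
  zero_eq_top := by simp [symbolicPower, Ideal.one_eq_top, Ideal.map_top]
  antitone _ _ h :=
    iInf₂_mono fun _ _ => Ideal.comap_mono (Ideal.map_mono (Ideal.pow_le_pow_right h))
  mul_le i j := by
    refine le_iInf₂ fun p hp => ?_
    rw [pow_add, Ideal.map_mul]
    exact (Ideal.mul_mono (iInf₂_le p hp) (iInf₂_le p hp)).trans (Ideal.le_comap_mul _)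

/-! Let `S` be the Rees algebra of the filtration on `A = R_Q`, with maximal ideal `m`. `S` need not
be Noetherian, but for `0 ≠ c ∈ I₁` it is birational to `A[ct]`, and the dimension inequality
(`IsBirationalOverAdjoin.heightLeAddOne`) gives every prime of `S` height at most `dim A + 1`. A
chain of `ℓ` steps above `mS` that starts in height at least `n + 1` therefore has `n + ℓ ≤ dim A`.
Taking `n = 0` gives `ℓ(𝓘) ≤ dim A`.

Away from the `P i`, prime avoidance yields `x ∈ Q` outside every `P i`, hence regular modulo every
symbolic power. A prime `q ⊇ mS` is then either maximal or of height at least 2, because a nonzero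
prime containing `S ∩ t⁻¹S` and avoiding `x` lies strictly below it (`analyticSpread_lt`).

At `P i` the filtration consists of the powers of `m`. The fibre cone maps onto `E/(t⁻¹)` for the
extended Rees algebra `E`, and Krull's height theorem bounds the dimension of that quotient below by
`dim A` (`le_analyticSpread_of_eq_pow`). -/

namespace Polynomial

/-! ### The dimension inequality -/

/-- A prime of `C[X]` has height at most one more than its contraction to the Noetherian ring `C`. -/
lemma height_le_height_comap_C_add_one {C : Type*} [CommRing C] [IsNoetherianRing C]
    (P : Ideal C[X]) [P.IsPrime] : P.height ≤ (P.comap Polynomial.C).height + 1 := by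
  set p := P.comap (Polynomial.C : C →+* C[X]) with hp
  -- Inverting `C ∖ p` preserves the height of `P` and reduces to `C_p[X]`, of dimension `ht p + 1`.
  let M : Submonoid C[X] := p.primeCompl.map (Polynomial.C : C →+* C[X])
  let _ : Algebra C[X] (Localization.AtPrime p)[X] :=
    (Polynomial.mapRingHom (algebraMap C (Localization.AtPrime p))).toAlgebra
  have : IsLocalization M (Localization.AtPrime p)[X] :=
    Polynomial.isLocalization p.primeCompl (Localization.AtPrime p)
  have hdisj : Disjoint (M : Set C[X]) (P : Set C[X]) := by
    rw [Set.disjoint_left]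
    rintro _ ⟨c, hc, rfl⟩ h
    exact hc h
  have := IsLocalization.isPrime_of_isPrime_disjoint M (Localization.AtPrime p)[X] P ‹_› hdisj
  rw [← IsLocalization.height_map_of_disjoint (S := (Localization.AtPrime p)[X]) M P hdisj]
  have h := Ideal.height_le_ringKrullDim_of_isPrime
    (I := P.map (algebraMap C[X] (Localization.AtPrime p)[X]))
  rw [Polynomial.ringKrullDim_of_isNoetherianRing,
    IsLocalization.AtPrime.ringKrullDim_eq_height p] at h
  exact_mod_cast h

end Polynomial

open Polynomial in
/-- If `D` is a quotient of `C[X]` by a nonzero ideal, heights do not increase from `C` to `D`. -/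
lemma height_le_height_comap_of_surjective_polynomial {C D : Type*} [CommRing C] [CommRing D]
    [IsDomain C] [IsNoetherianRing C] (φ : C[X] →+* D) (hφ : Function.Surjective φ)
    (hker : RingHom.ker φ ≠ ⊥) (P : Ideal D) [P.IsPrime] :
    P.height ≤ (P.comap (φ.comp Polynomial.C)).height := by
  -- A chain pulled back to the domain `C[X]` starts above the nonzero kernel, so `⊥` can be put
  -- below it. The extra step cancels the `+ 1` for `C[X]`.
  have h1 : P.height + 1 ≤ (P.comap φ).height := by
    have : P.height ≤ (P.comap φ).height - 1 := by
      rw [show P.height = Order.height (⟨P, ‹_›⟩ : PrimeSpectrum D) from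
        PrimeSpectrum.height_eq_orderHeight ⟨P, ‹_›⟩]
      refine Order.height_le fun l hl => ?_
      have hmono : StrictMono (PrimeSpectrum.comap φ) :=
        Monotone.strictMono_of_injective (fun _ _ hab ↦ Ideal.comap_mono hab)
          (PrimeSpectrum.comap_injective_of_surjective φ hφ)
      let l' := (l.map _ hmono).cons (⟨⊥, Ideal.isPrime_bot⟩ : PrimeSpectrum C[X]) (by
        refine lt_of_le_of_ne (show (⊥ : Ideal C[X]) ≤ _ from bot_le) fun h => hker ?_
        rw [eq_bot_iff]
        rw [show (⊥ : Ideal C[X]) = _ from h]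
        exact Ideal.ker_le_comap φ)
      have h := Order.length_le_height_last (p := l')
      have hlast : l'.last.asIdeal = P.comap φ := by
        simp only [l', RelSeries.last_cons]
        rw [LTSeries.last_map, hl]
        rfl
      rw [← PrimeSpectrum.height_eq_orderHeight, hlast] at h
      have h2 : l'.length = l.length + 1 := by simp [l']
      rw [h2] at h
      push_cast at h
      exact ENat.le_sub_of_add_le_right ENat.one_ne_top h
    have hpos : 1 ≤ (P.comap φ).height := by
      rw [Order.one_le_iff_ne_zero, Ne, Ideal.height_eq_zero_iff_eq_bot]
      exact fun h => hker (eq_bot_iff.2 (h ▸ Ideal.ker_le_comap φ))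
    calc _ ≤ _ := add_le_add this le_rfl
      _ = _ := tsub_add_cancel_of_le hpos
  have h2 := h1.trans (height_le_height_comap_C_add_one (P.comap φ))
  exact (WithTop.add_le_add_iff_right ENat.one_ne_top).1 h2

section DimensionInequality

open Polynomial

variable {A S : Type*} [CommRing A] [CommRing S] [Algebra A S]

/-- Primes of `U` have height at most one more than their contraction to `A`. -/
def HeightLeAddOne (A U : Type*) [CommRing A] [CommRing U] [Algebra A U] : Prop :=
  ∀ P : Ideal U, P.IsPrime → P.height ≤ (P.comap (algebraMap A U)).height + 1

/-- Every element of `S` becomes an element of `A[f]` on multiplying by a nonzero constant. -/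
def IsBirationalOverAdjoin (A : Type*) {S : Type*} [CommRing A] [CommRing S] [Algebra A S]
    (f : S) : Prop :=
  ∀ b : S, ∃ d : A, algebraMap A S d ≠ 0 ∧ d • b ∈ Algebra.adjoin A {f}

lemma heightLeAddOne_range_aeval [IsNoetherianRing A] (f : S) :
    IsNoetherianRing (aeval (R := A) f).range ∧ HeightLeAddOne A (aeval (R := A) f).range := by
  have hs : Function.Surjective (aeval (R := A) f).rangeRestrict.toRingHom :=
    (aeval (R := A) f).rangeRestrict_surjective
  refine ⟨isNoetherianRing_of_surjective _ _ _ hs, fun P hP => ?_⟩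
  refine (?_ : P.height ≤ (P.comap (aeval (R := A) f).rangeRestrict.toRingHom).height).trans ?_
  · have hmono : StrictMono (PrimeSpectrum.comap (aeval (R := A) f).rangeRestrict.toRingHom) :=
      Monotone.strictMono_of_injective (fun _ _ hab ↦ Ideal.comap_mono hab)
        (PrimeSpectrum.comap_injective_of_surjective _ hs)
    have := Order.height_le_height_apply_of_strictMono _ hmono ⟨P, hP⟩
    rw [← PrimeSpectrum.height_eq_orderHeight, ← PrimeSpectrum.height_eq_orderHeight] at this
    exact this
  · refine (height_le_height_comap_C_add_one _).trans (le_of_eq ?_)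
    rw [Ideal.comap_comap]
    congr 3
    ext a
    simp

/-- `U[b]` is a quotient of `U[X]` by an ideal containing `dX - db ≠ 0`, so adjoining `b` costs no
height and the bound stays at `+ 1`. -/
lemma exists_subalgebra_heightLeAddOne_insert [IsDomain S] (U : Subalgebra A S)
    [IsNoetherianRing U] (hU : HeightLeAddOne A U) (b : S) (d : A)
    (hd : algebraMap A S d ≠ 0) (hdb : d • b ∈ U) :
    ∃ V : Subalgebra A S, U ≤ V ∧ b ∈ V ∧ IsNoetherianRing V ∧ HeightLeAddOne A V := by
  let φ : U[X] →ₐ[U] S := aeval b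
  have hs : Function.Surjective φ.rangeRestrict.toRingHom := φ.rangeRestrict_surjective
  have hker : RingHom.ker φ.rangeRestrict.toRingHom ≠ ⊥ := by
    intro h
    have h0 : (C (algebraMap A U d) * X - C ⟨d • b, hdb⟩ : U[X]) ∈
        RingHom.ker φ.rangeRestrict.toRingHom := by
      rw [RingHom.mem_ker]
      apply Subtype.ext
      simp only [AlgHom.toRingHom_eq_coe, RingHom.coe_coe, AlgHom.coe_codRestrict,
        AlgHom.rangeRestrict]
      simp [φ, Algebra.smul_def]
    rw [h, Ideal.mem_bot] at h0
    have h1 := congrArg (fun g => ((g.coeff 1 : U) : S)) h0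
    simp [coeff_C] at h1
    exact hd h1
  refine ⟨φ.range.restrictScalars A, ?_, ?_, ?_, ?_⟩
  · intro u hu
    exact ⟨C ⟨u, hu⟩, by simp [φ]⟩
  · exact ⟨X, by simp [φ]⟩
  · exact isNoetherianRing_of_surjective _ φ.range _ hs
  · have h (P : Ideal φ.range) [P.IsPrime] :
        P.height ≤ (P.comap (algebraMap A φ.range)).height + 1 := by
      refine (height_le_height_comap_of_surjective_polynomial _ hs hker P).trans
        ((hU _ inferInstance).trans (le_of_eq ?_))
      rw [Ideal.comap_comap]
      congr 3
      ext a
      simp [φ]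
    exact fun P hP => @h P hP

/-- The dimension inequality for a domain that is birational to `A[f]`. -/
lemma IsBirationalOverAdjoin.heightLeAddOne [IsDomain S] [IsNoetherianRing A] {f : S}
    (hf : IsBirationalOverAdjoin A f) : HeightLeAddOne A S := by
  classical
  have key : ∀ T : Finset S, ∃ U : Subalgebra A S, (f ∈ U ∧ ∀ t ∈ T, t ∈ U) ∧
      IsNoetherianRing U ∧ HeightLeAddOne A U := by
    intro T
    induction T using Finset.induction_on with
    | empty =>
      exact ⟨(aeval f).range, ⟨⟨X, by simp⟩, by simp⟩, heightLeAddOne_range_aeval f⟩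
    | insert b T hb ih =>
      obtain ⟨U, ⟨hfU, hT⟩, hN, hU⟩ := ih
      obtain ⟨d, hd, hdb⟩ := hf b
      have hle : Algebra.adjoin A {f} ≤ U := Algebra.adjoin_le (by simpa using hfU)
      obtain ⟨V, hUV, hbV, hV⟩ := exists_subalgebra_heightLeAddOne_insert U hU b d hd (hle hdb)
      refine ⟨V, ⟨hUV hfU, fun t ht => ?_⟩, hV⟩
      rcases Finset.mem_insert.1 ht with rfl | ht
      exacts [hbV, hUV (hT t ht)]
  intro P hP
  rw [show P.height = Order.height (⟨P, ‹_›⟩ : PrimeSpectrum S) from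
    PrimeSpectrum.height_eq_orderHeight ⟨P, ‹_›⟩]
  refine Order.height_le fun l hl => ?_
  -- One witness per strict inclusion: the chain stays strict when contracted to a Noetherian
  -- subalgebra containing these finitely many elements.
  have hw : ∀ i : Fin l.length, ∃ a : S, a ∈ (l i.succ).asIdeal ∧ a ∉ (l i.castSucc).asIdeal :=
    fun i => Set.exists_of_ssubset (l.step i)
  choose a ha ha' using hw
  obtain ⟨U, ⟨-, hU⟩, hN, hht⟩ := key (Finset.univ.image a)
  let l' : LTSeries (PrimeSpectrum U) :=
    { length := l.length
      toFun := fun i => PrimeSpectrum.comap U.val.toRingHom (l i)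
      step := fun i => by
        refine lt_of_le_of_ne (Ideal.comap_mono (f := U.val.toRingHom) (l.step i).le)
          fun h => ?_
        have haU : a i ∈ U := hU _ (Finset.mem_image_of_mem _ (Finset.mem_univ i))
        have h1 : (⟨a i, haU⟩ : U) ∈
            (PrimeSpectrum.comap U.val.toRingHom (l i.succ)).asIdeal := ha i
        have h2 : (⟨a i, haU⟩ : U) ∈
            (PrimeSpectrum.comap U.val.toRingHom (l i.castSucc)).asIdeal :=
          h.ge h1
        exact ha' i h2 }
  have h := Order.length_le_height_last (p := l')
  rw [← PrimeSpectrum.height_eq_orderHeight] at h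
  refine h.trans ((hht _ inferInstance).trans (le_of_eq ?_))
  have hlast : l'.last.asIdeal = P.comap U.val.toRingHom := by
    have : l.last.asIdeal = P := by rw [hl]
    rw [← this]
    rfl
  rw [hlast, Ideal.comap_comap]
  rfl

end DimensionInequality

/-! ### Upper bounds for the analytic spread -/

lemma LTSeries.add_length_le_height_last {α : Type*} [Preorder α] (l : LTSeries α) {n : ℕ}
    (hn : n ≤ Order.height l.head) : ((n + l.length : ℕ) : ℕ∞) ≤ Order.height l.last := by
  obtain ⟨p, hp, rfl⟩ := Order.exists_series_of_le_height l.head hn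
  have h := Order.length_le_height_last (p := p.smash l hp)
  simpa using h

/-- The dimension of `S ⧸ 𝔟` is bounded by the lengths of the chains of primes above `𝔟`. -/
lemma ringKrullDim_quotient_le_of_forall_ltSeries {S : Type*} [CommRing S] (𝔟 : Ideal S)
    (d : WithBot ℕ∞)
    (h : ∀ l : LTSeries (PrimeSpectrum S), 𝔟 ≤ l.head.asIdeal → (l.length : WithBot ℕ∞) ≤ d) :
    ringKrullDim (S ⧸ 𝔟) ≤ d := by
  refine iSup_le fun l => ?_
  have hmono : StrictMono (PrimeSpectrum.comap (Ideal.Quotient.mk 𝔟)) :=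
    Monotone.strictMono_of_injective (fun _ _ hab ↦ Ideal.comap_mono hab)
      (PrimeSpectrum.comap_injective_of_surjective _ Ideal.Quotient.mk_surjective)
  refine h (l.map _ hmono) ?_
  rw [LTSeries.head_map]
  intro x hx
  change Ideal.Quotient.mk 𝔟 x ∈ l.head.asIdeal
  rw [Ideal.Quotient.eq_zero_iff_mem.2 hx]
  exact zero_mem _

namespace IdealFiltration

open Polynomial IsLocalRing

section

variable {A : Type*} [CommRing A] (F : IdealFiltration A)

/-- The element `a tⁿ` of the Rees algebra. -/
noncomputable def reesMonomial (n : ℕ) (a : A) (ha : a ∈ F.ideal n) : F.reesAlgebra :=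
  ⟨monomial n a, fun k => by
    rw [coeff_monomial]
    split_ifs with h
    · exact h ▸ ha
    · exact zero_mem _⟩

lemma mem_of_forall_reesMonomial_mem (P : Ideal F.reesAlgebra) (b : F.reesAlgebra)
    (h : ∀ n, F.reesMonomial n ((b : A[X]).coeff n) (b.2 n) ∈ P) : b ∈ P := by
  have : b = ∑ n ∈ (b : A[X]).support, F.reesMonomial n ((b : A[X]).coeff n) (b.2 n) := by
    apply Subtype.ext
    rw [AddSubmonoidClass.coe_finsetSum]
    exact (b : A[X]).as_sum_support
  rw [this]
  exact sum_mem fun n _ => h n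

lemma reesMonomial_zero_mem_map {n : ℕ} {J : Ideal A} {a : A} (ha : a ∈ F.ideal n) (haJ : a ∈ J)
    (hn : n = 0) : F.reesMonomial n a ha ∈ J.map (algebraMap A F.reesAlgebra) := by
  subst hn
  have : F.reesMonomial 0 a ha = algebraMap A F.reesAlgebra a := by
    apply Subtype.ext
    simp [reesMonomial]
  rw [this]
  exact Ideal.mem_map_of_mem _ haJ

/-- The ideal `S ∩ t⁻¹ S` of the Rees algebra `S`. -/
noncomputable def shiftIdeal : Ideal F.reesAlgebra where
  carrier := {s | X * (s : A[X]) ∈ F.reesAlgebra}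
  add_mem' {a b} ha hb := by
    change (X * ((a + b : F.reesAlgebra) : A[X])) ∈ F.reesAlgebra
    rw [Subalgebra.coe_add, mul_add]
    exact add_mem ha hb
  zero_mem' := by simp
  smul_mem' r s hs := by
    change (X * ((r * s : F.reesAlgebra) : A[X])) ∈ F.reesAlgebra
    rw [Subalgebra.coe_mul, mul_left_comm]
    exact mul_mem r.2 hs

lemma mem_shiftIdeal {s : F.reesAlgebra} :
    s ∈ F.shiftIdeal ↔ ∀ n, (s : A[X]).coeff n ∈ F.ideal (n + 1) := by
  refine ⟨fun h n => by simpa using h (n + 1), fun h n => ?_⟩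
  cases n with
  | zero => simp
  | succ n => simpa using h n

/-- A prime over `m` that misses some `a tⁿ` with `n > 0` contains `S ∩ t⁻¹ S`. -/
lemma shiftIdeal_le [IsLocalRing A] (hle : F.ideal 1 ≤ maximalIdeal A) (q : Ideal F.reesAlgebra)
    [q.IsPrime] (hq : (maximalIdeal A).map (algebraMap A F.reesAlgebra) ≤ q) (n : ℕ) (a : A)
    (ha : a ∈ F.ideal (n + 1)) (haq : F.reesMonomial (n + 1) a ha ∉ q) : F.shiftIdeal ≤ q := by
  intro s hs
  have ha' : a ∈ F.ideal n := F.antitone n.le_succ ha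
  have haq' : F.reesMonomial n a ha' ∈ q := by
    -- `(a tⁿ)ⁿ⁺¹ = (a tⁿ⁺¹)ⁿ · a`, and `a ∈ m`.
    refine Ideal.IsPrime.mem_of_pow_mem ‹_› (n + 1) ?_
    have : F.reesMonomial n a ha' ^ (n + 1) =
        F.reesMonomial (n + 1) a ha ^ n * algebraMap A F.reesAlgebra a := by
      apply Subtype.ext
      rw [Subalgebra.coe_pow, Subalgebra.coe_mul, Subalgebra.coe_pow, Subalgebra.coe_algebraMap]
      simp only [reesMonomial, monomial_pow, Polynomial.algebraMap_apply, Algebra.algebraMap_self,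
        RingHom.id_apply, monomial_mul_C]
      rw [pow_succ, mul_comm n]
    rw [this]
    exact Ideal.mul_mem_left _ _ (hq (Ideal.mem_map_of_mem _
      (hle (F.antitone (Nat.succ_le_succ n.zero_le) ha))))
  refine (Ideal.IsPrime.mem_or_mem ‹_› (?_ : s * F.reesMonomial (n + 1) a ha ∈ q)).resolve_right haq
  have : s * F.reesMonomial (n + 1) a ha = ⟨X * (s : A[X]), hs⟩ * F.reesMonomial n a ha' := by
    apply Subtype.ext
    simp only [Subalgebra.coe_mul, reesMonomial]
    rw [mul_right_comm, mul_comm (_ * _) (s : A[X]), X_mul_monomial]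
  rw [this]
  exact Ideal.mul_mem_left _ _ haq'

end

section

variable {A : Type*} [CommRing A] [IsDomain A] (F : IdealFiltration A)

/-- Since `cⁿ · a tⁿ = a (ct)ⁿ`, a power of `c` clears each monomial. -/
lemma isBirationalOverAdjoin_reesMonomial (c : A) (hc : c ≠ 0) (hc1 : c ∈ F.ideal 1) :
    IsBirationalOverAdjoin A (F.reesMonomial 1 c hc1) := by
  intro b
  have key : ∀ g : A[X], ∃ d : A, d ≠ 0 ∧ d • g ∈ Algebra.adjoin A {(monomial 1 c : A[X])} := by
    intro g
    induction g using Polynomial.induction_on' with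
    | add p q hp hq =>
      obtain ⟨d, hd, hp⟩ := hp
      obtain ⟨e, he, hq⟩ := hq
      refine ⟨d * e, mul_ne_zero hd he, ?_⟩
      rw [smul_add, mul_comm d e, mul_smul, mul_comm e d, mul_smul]
      exact add_mem (Subalgebra.smul_mem _ hp _) (Subalgebra.smul_mem _ hq _)
    | monomial n a =>
      refine ⟨c ^ n, pow_ne_zero _ hc, ?_⟩
      have : c ^ n • (monomial n a : A[X]) = a • (monomial 1 c : A[X]) ^ n := by
        simp only [monomial_pow, smul_monomial, smul_eq_mul, mul_comm, mul_one]
      rw [this]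
      exact Subalgebra.smul_mem _ (pow_mem (Algebra.self_mem_adjoin_singleton A _) n) _
  obtain ⟨d, hd, h⟩ := key b
  refine ⟨d, fun h0 => hd ?_, ?_⟩
  · have := congrArg (Subtype.val) h0
    simpa using this
  · have hmap : (Algebra.adjoin A {F.reesMonomial 1 c hc1}).map F.reesAlgebra.val =
        Algebra.adjoin A {(monomial 1 c : A[X])} := by
      rw [AlgHom.map_adjoin, Set.image_singleton]
      rfl
    rw [← hmap] at h
    obtain ⟨y, hy, hyb⟩ := h
    have : y = d • b := Subtype.ext hyb
    exact this ▸ hy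

variable [IsNoetherianRing A] [IsLocalRing A]

lemma height_le_height_maximalIdeal_add_one (h1 : F.ideal 1 ≠ ⊥) (P : Ideal F.reesAlgebra)
    [P.IsPrime] : P.height ≤ (maximalIdeal A).height + 1 := by
  obtain ⟨c, hc, hc0⟩ := Submodule.exists_mem_ne_zero_of_ne_bot h1
  refine ((F.isBirationalOverAdjoin_reesMonomial c hc0 hc).heightLeAddOne P ‹_›).trans ?_
  gcongr
  exact le_maximalIdeal Ideal.IsPrime.ne_top'

/-- If the chains of primes above `m S` start in height at least `n + 1` then `ℓ + n ≤ dim A`. -/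
lemma length_add_le_height (h1 : F.ideal 1 ≠ ⊥) (l : LTSeries (PrimeSpectrum F.reesAlgebra))
    {n : ℕ} (hn : (n + 1 : ℕ) ≤ l.head.asIdeal.height) :
    ((n + l.length : ℕ) : ℕ∞) ≤ (maximalIdeal A).height := by
  rw [PrimeSpectrum.height_eq_orderHeight] at hn
  have h2 := l.add_length_le_height_last hn
  rw [← PrimeSpectrum.height_eq_orderHeight] at h2
  have h3 := h2.trans (F.height_le_height_maximalIdeal_add_one h1 l.last.asIdeal)
  rw [add_right_comm, Nat.cast_add _ 1, Nat.cast_one] at h3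
  exact (WithTop.add_le_add_iff_right ENat.one_ne_top).1 h3

theorem analyticSpread_le (h1 : F.ideal 1 ≠ ⊥) (hm : maximalIdeal A ≠ ⊥) :
    F.analyticSpread ≤ (maximalIdeal A).height := by
  refine ringKrullDim_quotient_le_of_forall_ltSeries _ _ fun l hl => ?_
  have h0 : ((0 + 1 : ℕ) : ℕ∞) ≤ l.head.asIdeal.height := by
    rw [zero_add, Nat.cast_one, Order.one_le_iff_ne_zero, Ne,
      Ideal.height_eq_zero_iff_eq_bot]
    intro hb
    obtain ⟨x, hx, hx0⟩ := Submodule.exists_mem_ne_zero_of_ne_bot hm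
    have := hl (Ideal.mem_map_of_mem _ hx)
    rw [hb, Ideal.mem_bot] at this
    exact hx0 (by simpa using congrArg Subtype.val this)
  have := F.length_add_le_height h1 l h0
  rw [zero_add] at this
  exact_mod_cast this

/-- If some `x ∈ m` is a nonzerodivisor modulo each `Iₙ`, then `ℓ(𝓘) < dim A`. -/
theorem analyticSpread_lt (h1 : F.ideal 1 ≠ ⊥) (hle : F.ideal 1 ≤ maximalIdeal A)
    (x : A) (hx : x ∈ maximalIdeal A) (hreg : ∀ n s, x * s ∈ F.ideal n → s ∈ F.ideal n) :
    F.analyticSpread < (maximalIdeal A).height := by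
  have hm : maximalIdeal A ≠ ⊥ := fun h => h1 (le_bot_iff.1 (h ▸ hle))
  obtain ⟨d, hd⟩ := ENat.ne_top_iff_exists.1 (Ideal.height_ne_top_of_isPrime (I := maximalIdeal A))
  have hdpos : d ≠ 0 := by
    rintro rfl
    exact hm (Ideal.height_eq_zero_iff_eq_bot.1 hd.symm)
  suffices F.analyticSpread ≤ ((d - 1 : ℕ) : ℕ∞) by
    refine this.trans_lt ?_
    rw [← hd]
    exact_mod_cast Nat.sub_one_lt hdpos
  refine ringKrullDim_quotient_le_of_forall_ltSeries _ _ fun l hl => ?_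
  suffices l.length ≤ d - 1 by exact_mod_cast this
  set q := l.head.asIdeal with hqdef
  -- If `q` contains everything of positive degree, `S/q` is the residue field. A strictly larger
  -- prime would contain an element with unit constant term, hence a unit.
  by_cases hirr : ∀ n a (ha : a ∈ F.ideal (n + 1)), F.reesMonomial (n + 1) a ha ∈ q
  · by_contra! hlen
    have hlt := l.step ⟨0, by omega⟩
    obtain ⟨b, hb, hbq⟩ := Set.exists_of_ssubset hlt
    change b ∉ q at hbq
    set q' := (l.toFun (Fin.succ ⟨0, by omega⟩)).asIdeal with hq'
    have hle' : q ≤ q' := hlt.le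
    refine (Ideal.IsPrime.ne_top' : q' ≠ ⊤) ?_
    by_cases hb0 : (b : A[X]).coeff 0 ∈ maximalIdeal A
    · refine absurd (F.mem_of_forall_reesMonomial_mem q b fun n => ?_) hbq
      cases n with
      | zero => exact hl (F.reesMonomial_zero_mem_map _ hb0 rfl)
      | succ n => exact hirr n _ _
    · have hunit : IsUnit ((b : A[X]).coeff 0) := by simpa using hb0
      refine Ideal.eq_top_of_isUnit_mem _ ?_ (hunit.map (algebraMap A F.reesAlgebra))
      have : b - algebraMap A F.reesAlgebra ((b : A[X]).coeff 0) ∈ q := by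
        refine F.mem_of_forall_reesMonomial_mem q _ fun n => ?_
        cases n with
        | zero => exact hl (F.reesMonomial_zero_mem_map _ (by simp) rfl)
        | succ n => exact hirr n _ _
      have := sub_mem hb (hle' this)
      rwa [sub_sub_cancel] at this
  · push Not at hirr
    obtain ⟨n, a, ha, haq⟩ := hirr
    have hsq : F.shiftIdeal ≤ q := F.shiftIdeal_le hle q hl n a ha haq
    -- A prime disjoint from `M` lies inside `q` and omits `x`. Disjointness from `S ∩ t⁻¹S` holds
    -- because powers of `x` cancel modulo each `Iₙ`, leaving an element of `q`.
    let M : Submonoid F.reesAlgebra := Submonoid.powers (algebraMap A F.reesAlgebra x) ⊔ q.primeCompl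
    have hdisj : Disjoint (F.shiftIdeal : Set F.reesAlgebra) M := by
      rw [Set.disjoint_left]
      rintro z hz hzM
      obtain ⟨_, ⟨k, rfl⟩, s, hs, rfl⟩ := Submonoid.mem_sup.1 hzM
      refine hs (hsq ?_)
      rw [SetLike.mem_coe, mem_shiftIdeal] at hz
      rw [mem_shiftIdeal]
      intro j
      replace hz := hz j
      simp only [← map_pow, Subalgebra.coe_mul, Subalgebra.coe_algebraMap,
        Polynomial.algebraMap_apply, Algebra.algebraMap_self, RingHom.id_apply, coeff_C_mul] at hz
      clear hzM
      induction k with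
      | zero => simpa using hz
      | succ k ih => exact ih (hreg _ _ (by rwa [pow_succ', mul_assoc] at hz))
    obtain ⟨p, hp, hpS, hpM⟩ := Ideal.exists_le_prime_disjoint _ M hdisj
    have hp0 : p ≠ ⊥ := by
      intro h
      obtain ⟨c, hc, hc0⟩ := Submodule.exists_mem_ne_zero_of_ne_bot h1
      have : algebraMap A F.reesAlgebra c ∈ p := hpS (by
        rw [mem_shiftIdeal]
        intro n
        rw [Subalgebra.coe_algebraMap, Polynomial.algebraMap_apply, coeff_C]
        split_ifs with hn
        · subst hn; exact hc
        · exact zero_mem _)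
      rw [h, Ideal.mem_bot] at this
      exact hc0 (by simpa using congrArg Subtype.val this)
    have hpq : p < q := by
      refine lt_of_le_of_ne (fun y hy => ?_) fun h => ?_
      · by_contra hyq
        exact Set.disjoint_left.1 hpM hy ((le_sup_right : q.primeCompl ≤ M) hyq)
      · have hxq : algebraMap A F.reesAlgebra x ∈ q := hl (Ideal.mem_map_of_mem _ hx)
        rw [← h] at hxq
        exact Set.disjoint_left.1 hpM hxq
          ((le_sup_left : Submonoid.powers _ ≤ M) (Submonoid.mem_powers _))
    have hht : ((1 + 1 : ℕ) : ℕ∞) ≤ q.height := by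
      refine le_trans ?_ (Ideal.height_add_one_le_of_lt_of_isPrime hpq)
      rw [Nat.cast_add, Nat.cast_one]
      refine add_le_add ?_ le_rfl
      rw [Order.one_le_iff_ne_zero, Ne, Ideal.height_eq_zero_iff_eq_bot]
      exact hp0
    have := F.length_add_le_height h1 l hht
    rw [← hd] at this
    have : 1 + l.length ≤ d := by exact_mod_cast this
    omega

end

end IdealFiltration

/-! ### The extended Rees algebra and the lower bound -/

section ExtendedRees

open Polynomial LaurentPolynomial

variable {A : Type*} [CommRing A] (I : Ideal A)

/-- The extended Rees algebra `A[I t, t⁻¹]` on a set `s` of generators of `I`, presented as the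
range of a polynomial ring. -/
noncomputable def extendedReesPresentation (s : Finset A) :
    MvPolynomial (Option s) A →ₐ[A] A[T;T⁻¹] :=
  MvPolynomial.aeval fun o => o.elim (T (-1)) fun x => LaurentPolynomial.C (x : A) * T 1

/-- Laurent polynomials whose coefficient in each degree `n ≥ 0` lies in `Iⁿ`. -/
noncomputable def laurentRees : Subalgebra A A[T;T⁻¹] where
  carrier := {g | ∀ n : ℤ, g.coeff n ∈ I ^ n.toNat}
  mul_mem' {f g} hf hg n := by
    rw [AddMonoidAlgebra.coeff_mul]
    refine Ideal.sum_mem _ fun i _ => Ideal.sum_mem _ fun j _ => ?_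
    dsimp only
    split_ifs with h
    · have := Ideal.mul_mem_mul (hf i) (hg j)
      rw [← pow_add] at this
      -- `Int.toNat` is subadditive.
      exact Ideal.pow_le_pow_right (by omega) this
    · exact zero_mem _
  add_mem' {f g} hf hg n := by
    simpa using add_mem (hf n) (hg n)
  algebraMap_mem' r n := by
    rw [← LaurentPolynomial.C_eq_algebraMap, LaurentPolynomial.C_apply]
    split_ifs with h
    · simp [h]
    · exact zero_mem _

variable {I} {s : Finset A}

/-- The presentation gives Noetherianity; this inclusion gives control of the coefficients. -/
lemma range_extendedReesPresentation_le (hs : Ideal.span (s : Set A) = I) :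
    (extendedReesPresentation s).range ≤ laurentRees I := by
  rw [extendedReesPresentation, ← Algebra.adjoin_range_eq_range_aeval]
  refine Algebra.adjoin_le ?_
  rintro _ ⟨_ | x, rfl⟩ n
  · change (T (-1) : A[T;T⁻¹]).coeff n ∈ _
    rw [LaurentPolynomial.T_apply]
    split_ifs with h
    · simp [← h]
    · exact zero_mem _
  · change (LaurentPolynomial.C (x : A) * T 1).coeff n ∈ _
    rw [← LaurentPolynomial.single_eq_C_mul_T, AddMonoidAlgebra.coeff_single,
      Finsupp.single_apply]
    split_ifs with h
    · rw [← h, Int.toNat_one, pow_one, ← hs]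
      exact Ideal.subset_span x.2
    · exact zero_mem _

lemma C_mul_T_one_mem_range (hs : Ideal.span (s : Set A) = I) {x : A} (hx : x ∈ I) :
    LaurentPolynomial.C x * T 1 ∈ (extendedReesPresentation s).range := by
  rw [← hs] at hx
  induction hx using Submodule.span_induction with
  | mem x hx => exact ⟨MvPolynomial.X (some ⟨x, hx⟩), by simp [extendedReesPresentation]⟩
  | zero => simp
  | add x y _ _ hx hy =>
    rw [map_add, add_mul]
    exact add_mem hx hy
  | smul a x _ hx =>
    rw [smul_eq_mul, map_mul, mul_assoc, ← LaurentPolynomial.smul_eq_C_mul]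
    exact Subalgebra.smul_mem _ hx a

lemma toLaurent_mem_range (hs : Ideal.span (s : Set A) = I) {f : A[X]}
    (hf : f ∈ reesAlgebra I) : toLaurent f ∈ (extendedReesPresentation s).range := by
  rw [← adjoin_monomial_eq_reesAlgebra] at hf
  have hle : Algebra.adjoin A (Submodule.map (monomial 1 : A →ₗ[A] A[X]) I : Set A[X]) ≤
      (extendedReesPresentation s).range.comap toLaurentAlg := by
    refine Algebra.adjoin_le ?_
    rintro _ ⟨x, hx, rfl⟩
    have := C_mul_T_one_mem_range hs hx
    simpa [← C_mul_X_eq_monomial] using this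
  exact hle hf

/-- The prime `p A[t, t⁻¹] ∩ E` of the extended Rees algebra. -/
noncomputable def laurentPrime (E : Subalgebra A A[T;T⁻¹]) (p : PrimeSpectrum A) :
    PrimeSpectrum E :=
  PrimeSpectrum.comap ((AddMonoidAlgebra.mapRingHom ℤ (Ideal.Quotient.mk p.asIdeal)).comp
    E.val.toRingHom) (⊥ : PrimeSpectrum ((A ⧸ p.asIdeal)[T;T⁻¹]))

lemma mem_laurentPrime (E : Subalgebra A A[T;T⁻¹]) (p : PrimeSpectrum A) (g : E) :
    g ∈ (laurentPrime E p).asIdeal ↔ ∀ n, (g : A[T;T⁻¹]).coeff n ∈ p.asIdeal := by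
  change AddMonoidAlgebra.mapRingHom ℤ (Ideal.Quotient.mk p.asIdeal) (g : A[T;T⁻¹]) = 0 ↔ _
  rw [LaurentPolynomial.ext_iff]
  simp [Ideal.Quotient.eq_zero_iff_mem]

lemma laurentPrime_strictMono (E : Subalgebra A A[T;T⁻¹]) : StrictMono (laurentPrime E) := by
  have hmono : Monotone (laurentPrime E) := by
    intro p q hpq g hg
    rw [mem_laurentPrime] at hg ⊢
    exact fun n => hpq (hg n)
  refine hmono.strictMono_of_injective fun p q h => ?_
  ext a
  have h1 : ∀ p : PrimeSpectrum A, algebraMap A E a ∈ (laurentPrime E p).asIdeal ↔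
      a ∈ p.asIdeal := by
    intro p
    rw [mem_laurentPrime, Subalgebra.coe_algebraMap, ← LaurentPolynomial.C_eq_algebraMap]
    refine ⟨fun h => by simpa using h 0, fun h n => ?_⟩
    rw [LaurentPolynomial.C_apply]
    split_ifs
    exacts [h, zero_mem _]
  rw [← h1 p, h, h1 q]

end ExtendedRees

namespace IdealFiltration

open Polynomial IsLocalRing LaurentPolynomial

variable {A : Type*} [CommRing A] [IsNoetherianRing A] [IsLocalRing A] (F : IdealFiltration A)

/-- `dim A` is at most the dimension of the fibre cone of the maximal ideal. -/
theorem le_analyticSpread_of_eq_pow (hF : ∀ n, F.ideal n = maximalIdeal A ^ n) :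
    (maximalIdeal A).height ≤ F.analyticSpread := by
  obtain ⟨s, hs⟩ := (isNoetherianRing_iff_ideal_fg A).1 ‹_› (maximalIdeal A)
  set φ := extendedReesPresentation s with hφ
  set E := φ.range
  have hEle : E ≤ laurentRees (maximalIdeal A) := range_extendedReesPresentation_le hs
  have : IsNoetherianRing E :=
    isNoetherianRing_of_surjective _ _ φ.rangeRestrict.toRingHom φ.rangeRestrict_surjective
  let u : E := ⟨T (-1), MvPolynomial.X none, by simp [hφ, extendedReesPresentation]⟩
  let M : PrimeSpectrum A := ⟨maximalIdeal A, inferInstance⟩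
  -- The degree 0 coefficient of `g + y t⁻¹` is `g₀ + y₁`, and both terms lie in `m`.
  have hne : (laurentPrime E M).asIdeal ⊔ Ideal.span {u} ≠ ⊤ := by
    rw [Ne, Ideal.eq_top_iff_one, Submodule.mem_sup]
    rintro ⟨g, hg, _, hy, h1⟩
    obtain ⟨y, rfl⟩ := Ideal.mem_span_singleton'.1 hy
    rw [mem_laurentPrime] at hg
    have h2 := congrArg (fun z : E => (z : A[T;T⁻¹]).coeff 0) h1
    have hy1 : (y : A[T;T⁻¹]).coeff 1 ∈ maximalIdeal A := by simpa using hEle y.2 1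
    have h3 : ((y * u : E) : A[T;T⁻¹]).coeff 0 = (y : A[T;T⁻¹]).coeff 1 := by
      change ((y : A[T;T⁻¹]) * T (-1)).coeff 0 = _
      rw [LaurentPolynomial.T, AddMonoidAlgebra.coeff_mul_single_eq_coeff_mul (m₂ := 1)
        fun m _ => by omega, mul_one]
    have h4 : (1 : A) ∈ maximalIdeal A := by
      have : (1 : A) = (g : A[T;T⁻¹]).coeff 0 + (y : A[T;T⁻¹]).coeff 1 := by
        rw [← h3]
        simpa using h2.symm
      rw [this]
      exact add_mem (hg 0) hy1
    exact (Ideal.ne_top_iff_one _).1 Ideal.IsPrime.ne_top' h4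
  obtain ⟨N, hN, hle⟩ := Ideal.exists_le_maximal _ hne
  have huN : u ∈ N := hle (Ideal.mem_sup_right (Ideal.mem_span_singleton_self u))
  have hlt : (laurentPrime E M).asIdeal < N := by
    refine lt_of_le_of_ne (le_sup_left.trans hle) fun h => ?_
    rw [← h, mem_laurentPrime] at huN
    have := huN (-1)
    simp [u] at this
    exact (Ideal.ne_top_iff_one _).1 (Ideal.IsPrime.ne_top' : M.asIdeal ≠ ⊤) this
  -- Chains in `A` lift through `laurentPrime` to chains ending at `laurentPrime E M`; `N` adds a
  -- step.
  have h1 : (maximalIdeal A).height + 1 ≤ N.height := by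
    refine le_trans (add_le_add ?_ le_rfl) (Ideal.height_add_one_le_of_lt_of_isPrime hlt)
    have := Order.height_le_height_apply_of_strictMono _ (laurentPrime_strictMono E) M
    rw [← PrimeSpectrum.height_eq_orderHeight, ← PrimeSpectrum.height_eq_orderHeight] at this
    exact this
  have h2 : (maximalIdeal A).height ≤ ringKrullDim (E ⧸ Ideal.span {u}) := by
    have h3 := Ideal.height_le_ringKrullDim_quotient_add_one huN
    have h4 : (((maximalIdeal A).height + 1 : ℕ∞) : WithBot ℕ∞) ≤ N.height := by exact_mod_cast h1
    revert h3
    cases ringKrullDim (E ⧸ Ideal.span {u}) with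
    | bot => exact fun h3 => absurd (h4.trans h3) (WithBot.not_coe_le_bot _)
    | coe k =>
      intro h3
      have h5 : (maximalIdeal A).height + 1 ≤ k + 1 := by exact_mod_cast h4.trans h3
      exact WithBot.coe_le_coe.2 ((WithTop.add_le_add_iff_right ENat.one_ne_top).1 h5)
  refine h2.trans ?_
  have hrees : ∀ f : F.reesAlgebra, (f : A[X]) ∈ _root_.reesAlgebra (maximalIdeal A) :=
    fun f n => hF n ▸ f.2 n
  let θ : F.reesAlgebra →+* E := (toLaurent.comp F.reesAlgebra.val.toRingHom).codRestrict E
    fun f => toLaurent_mem_range hs (hrees f)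
  let ψ : F.reesAlgebra →+* E ⧸ Ideal.span {u} := (Ideal.Quotient.mk _).comp θ
  have hker : ∀ a ∈ (maximalIdeal A).map (algebraMap A F.reesAlgebra), ψ a = 0 := by
    suffices (maximalIdeal A).map (algebraMap A F.reesAlgebra) ≤ RingHom.ker ψ from
      fun a ha => this ha
    rw [Ideal.map_le_iff_le_comap]
    intro x hx
    change Ideal.Quotient.mk _ (θ _) = 0
    rw [Ideal.Quotient.eq_zero_iff_mem, Ideal.mem_span_singleton']
    -- `x = (xt) · t⁻¹`.
    refine ⟨⟨_, C_mul_T_one_mem_range hs hx⟩, Subtype.ext ?_⟩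
    change LaurentPolynomial.C x * T 1 * T (-1) = toLaurent (Polynomial.C x)
    rw [LaurentPolynomial.mul_T_assoc]
    simp
  refine ringKrullDim_le_of_surjective (Ideal.Quotient.lift _ ψ hker)
    (Ideal.Quotient.lift_surjective_of_surjective _ hker ?_)
  -- Surjectivity on generators: `t⁻¹` dies, and each `xt` already lies in the Rees algebra.
  intro z
  obtain ⟨⟨_, q, rfl⟩, rfl⟩ := Ideal.Quotient.mk_surjective z
  induction q using MvPolynomial.induction_on with
  | C a =>
    refine ⟨algebraMap A _ a, congrArg (Ideal.Quotient.mk _) (Subtype.ext ?_)⟩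
    change toLaurent (Polynomial.C a) = φ (MvPolynomial.C a)
    rw [toLaurent_C, LaurentPolynomial.C_eq_algebraMap]
    exact (φ.commutes a).symm
  | add p q hp hq =>
    obtain ⟨f, hf⟩ := hp
    obtain ⟨g, hg⟩ := hq
    refine ⟨f + g, ?_⟩
    rw [map_add, hf, hg, ← map_add]
    exact congrArg (Ideal.Quotient.mk _) (Subtype.ext (map_add φ p q).symm)
  | mul_X p o hp =>
    obtain ⟨f, hf⟩ := hp
    cases o with
    | none =>
      refine ⟨0, ?_⟩
      rw [map_zero, eq_comm, Ideal.Quotient.eq_zero_iff_mem, Ideal.mem_span_singleton']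
      refine ⟨⟨φ p, p, rfl⟩, Subtype.ext ?_⟩
      change φ p * T (-1) = φ (p * MvPolynomial.X none)
      simp [hφ, extendedReesPresentation]
    | some x =>
      have hx : (x : A) ∈ F.ideal 1 := by
        rw [hF, pow_one, ← hs]
        exact Ideal.subset_span x.2
      refine ⟨f * F.reesMonomial 1 x hx, ?_⟩
      rw [map_mul, hf]
      change Ideal.Quotient.mk _ _ * Ideal.Quotient.mk _ _ = _
      rw [← map_mul]
      refine congrArg (Ideal.Quotient.mk _) (Subtype.ext ?_)
      change φ p * toLaurent (monomial 1 (x : A)) = φ (p * MvPolynomial.X (some x))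
      rw [map_mul]
      simp [hφ, extendedReesPresentation, ← C_mul_X_eq_monomial]

end IdealFiltration

/-! ### Symbolic powers of an intersection of primes of equal height -/

section Symbolic

variable {R : Type*} [CommRing R]

lemma mem_symbolicPower {I : Ideal R} {n : ℕ} {s : R} :
    s ∈ symbolicPower I n ↔ ∀ p : PrimeSpectrum R, p.asIdeal ∈ associatedPrimes R (R ⧸ I) →
      algebraMap R (Localization.AtPrime p.asIdeal) s ∈
        (I ^ n).map (algebraMap R (Localization.AtPrime p.asIdeal)) := by
  simp [symbolicPower]

lemma pow_le_symbolicPower (I : Ideal R) (n : ℕ) : I ^ n ≤ symbolicPower I n :=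
  fun _ hs => mem_symbolicPower.2 fun _ _ => Ideal.mem_map_of_mem _ hs

/-- Such an `x` becomes a unit in each localization that defines the symbolic power. -/
lemma mem_symbolicPower_of_mul_mem {I : Ideal R} {x : R}
    (hx : ∀ p ∈ associatedPrimes R (R ⧸ I), x ∉ p) {n : ℕ} {s : R}
    (h : x * s ∈ symbolicPower I n) : s ∈ symbolicPower I n := by
  rw [mem_symbolicPower] at h ⊢
  intro p hp
  have h' := h p hp
  rw [map_mul] at h'
  exact (Ideal.unit_mul_mem_iff_mem _ (IsLocalization.map_units (M := p.asIdeal.primeCompl) _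
    ⟨x, hx _ hp⟩)).1 h'

lemma map_symbolicPower_le {I p : Ideal R} [p.IsPrime] (hp : p ∈ associatedPrimes R (R ⧸ I))
    (hIp : I ≤ p) (n : ℕ) :
    (symbolicPower I n).map (algebraMap R (Localization.AtPrime p)) ≤
      IsLocalRing.maximalIdeal (Localization.AtPrime p) ^ n := by
  rw [Ideal.map_le_iff_le_comap]
  intro s hs
  have h := mem_symbolicPower.1 hs ⟨p, ‹_›⟩ hp
  rw [← Localization.AtPrime.map_eq_maximalIdeal, ← Ideal.map_pow]
  exact Ideal.map_mono (Ideal.pow_right_mono hIp n) h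

lemma symbolicPower_one_le {I p : Ideal R} [p.IsPrime] (hp : p ∈ associatedPrimes R (R ⧸ I))
    (hIp : I ≤ p) : symbolicPower I 1 ≤ p := by
  have h := map_symbolicPower_le hp hIp 1
  rw [pow_one, Ideal.map_le_iff_le_comap] at h
  exact h.trans (Localization.AtPrime.under_maximalIdeal (I := p)).le

lemma exists_le_of_iInf_le {r : ℕ} (P : Fin r → Ideal R) {Q : Ideal R} [hQ : Q.IsPrime]
    (h : ⨅ i, P i ≤ Q) : ∃ i, P i ≤ Q := by
  rw [← Finset.inf_univ_eq_iInf, hQ.inf_le'] at h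
  obtain ⟨i, -, hi⟩ := h
  exact ⟨i, hi⟩

lemma height_iInf_eq {r : ℕ} (P : Fin r → Ideal R) {h : ℕ} (hheight : ∀ i, (P i).height = h)
    (i : Fin r) : (⨅ i, P i).height = h := by
  refine le_antisymm ((Ideal.height_mono (iInf_le P i)).trans (hheight i).le) ?_
  rw [Ideal.height_eq_inf_minimalPrimes]
  refine le_iInf₂ fun p hp => ?_
  have := hp.isPrime
  obtain ⟨j, hj⟩ := exists_le_of_iInf_le P hp.1.2
  exact (hheight j).ge.trans (Ideal.height_mono hj)

variable {r : ℕ} (P : Fin r → Ideal R) [hP : ∀ i, (P i).IsPrime]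

/-- Write `p = (I : a)`. It contains the intersection of the `P i` with `a ∉ P i`, hence one of
them; and `p a ⊆ P i` with `a ∉ P i` gives the reverse inclusion. -/
lemma exists_eq_of_mem_associatedPrimes_iInf [IsNoetherianRing R]
    {p : Ideal R} (hp : p ∈ associatedPrimes R (R ⧸ ⨅ i, P i)) : ∃ i, p = P i := by
  classical
  rw [AssociatedPrimes.mem_iff, isAssociatedPrime_iff] at hp
  obtain ⟨hprime, x, hx⟩ := hp
  obtain ⟨a, rfl⟩ := Ideal.Quotient.mk_surjective x
  have hmem : ∀ s, s ∈ p ↔ ∀ i, s * a ∈ P i := by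
    intro s
    rw [hx, Submodule.mem_colon_singleton, Submodule.mem_bot, ← Ideal.mem_iInf,
      ← Ideal.Quotient.eq_zero_iff_mem, map_mul]
    rfl
  have hle : (Finset.univ.filter fun i => a ∉ P i).inf P ≤ p := by
    intro s hs
    rw [hmem]
    intro i
    by_cases ha : a ∈ P i
    · exact Ideal.mul_mem_left _ _ ha
    · exact Ideal.mul_mem_right _ _
        (Finset.inf_le (f := P) (Finset.mem_filter.2 ⟨Finset.mem_univ i, ha⟩) hs)
  obtain ⟨i, hi, hip⟩ := hprime.inf_le'.1 hle
  refine ⟨i, le_antisymm (fun s hs => ?_) hip⟩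
  exact (((hP i).mem_or_mem ((hmem s).1 hs i))).resolve_right (Finset.mem_filter.1 hi).2

lemma mem_associatedPrimes_iInf [IsNoetherianRing R] {h : ℕ} (hheight : ∀ i, (P i).height = h)
    (i : Fin r) : P i ∈ associatedPrimes R (R ⧸ ⨅ i, P i) := by
  refine Module.associatedPrimes.minimalPrimes_annihilator_subset_associatedPrimes R
    (R ⧸ ⨅ i, P i) ?_
  rw [Ideal.annihilator_quotient]
  exact Ideal.mem_minimalPrimes_of_height_le (iInf_le P i)
    (by rw [hheight, height_iInf_eq P hheight i])

lemma map_iInf_eq_maximalIdeal [IsNoetherianRing R] {h : ℕ} (hheight : ∀ i, (P i).height = h)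
    (i : Fin r) : (⨅ i, P i).map (algebraMap R (Localization.AtPrime (P i))) =
      IsLocalRing.maximalIdeal (Localization.AtPrime (P i)) := by
  classical
  rw [← Localization.AtPrime.map_eq_maximalIdeal]
  refine le_antisymm (Ideal.map_mono (iInf_le P i)) ?_
  rw [Ideal.map_le_iff_le_comap]
  intro x hx
  -- Equal heights rule out proper inclusions. The filter compares ideals, not indices, since the
  -- family may repeat. A `w` in the other primes but not in `P i` becomes a unit, and `w x ∈ I`.
  have hnot : ¬ (Finset.univ.filter fun j => P j ≠ P i).inf P ≤ P i := by
    rw [(hP i).inf_le']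
    rintro ⟨j, hj, hji⟩
    exact (Finset.mem_filter.1 hj).2
      ((P j).eq_of_le_of_height_le hji (by rw [hheight, hheight]))
  obtain ⟨w, hw, hwi⟩ := Set.not_subset.1 hnot
  rw [Ideal.mem_comap, IsLocalization.algebraMap_mem_map_algebraMap_iff (P i).primeCompl]
  refine ⟨w, hwi, ?_⟩
  rw [Ideal.mem_iInf]
  intro j
  by_cases hj : P j = P i
  · exact hj ▸ Ideal.mul_mem_left _ _ hx
  · exact Ideal.mul_mem_right _ _
      (Finset.inf_le (f := P) (Finset.mem_filter.2 ⟨Finset.mem_univ j, hj⟩) hw)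

end Symbolic

/-! ### The main theorem -/

lemma Localization.AtPrime.height_maximalIdeal {R : Type*} [CommRing R] (Q : Ideal R) [Q.IsPrime] :
    (IsLocalRing.maximalIdeal (Localization.AtPrime Q)).height = Q.height := by
  have h := IsLocalRing.maximalIdeal_height_eq_ringKrullDim (R := Localization.AtPrime Q)
  rw [IsLocalization.AtPrime.ringKrullDim_eq_height Q] at h
  exact_mod_cast h

theorem mainTheorem5 {R : Type*} [CommRing R] [IsDomain R] [IsLocalRing R] [IsNoetherianRing R]
    {r : ℕ} (P : Fin r → Ideal R) [∀ i, (P i).IsPrime]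
    (h : ℕ) (hpos : 0 < h) (hheight : ∀ i, (P i).height = h)
    (hreg : ∀ i, IsRegularLocalRing (Localization.AtPrime (P i)))
    (I : Ideal R) (hI : I = ⨅ i, P i) :
    (∀ (Q : Ideal R) [Q.IsPrime], I ≤ Q → (∀ i, Q ≠ P i) →
      ((symbolicFiltration I).localization Q).analyticSpread < (Q.height : WithBot ℕ∞)) ∧
    (∀ i, ((symbolicFiltration I).localization (P i)).analyticSpread =
        ((P i).height : WithBot ℕ∞) ∧
      (P i).height = I.height) := by
  subst hI
  have hdom (Q : Ideal R) [Q.IsPrime] : IsDomain (Localization.AtPrime Q) :=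
    IsLocalization.isDomain_localization Q.primeCompl_le_nonZeroDivisors
  have hinj (Q : Ideal R) [Q.IsPrime] :
      Function.Injective (algebraMap R (Localization.AtPrime Q)) :=
    IsLocalization.injective _ Q.primeCompl_le_nonZeroDivisors
  have hne (Q : Ideal R) [Q.IsPrime] (i : Fin r) :
      ((symbolicFiltration (⨅ i, P i)).localization Q).ideal 1 ≠ ⊥ := by
    have hI0 : (⨅ i, P i) ≠ ⊥ := by
      rw [Ne, ← Ideal.height_eq_zero_iff_eq_bot, height_iInf_eq P hheight i]
      exact_mod_cast hpos.ne'
    obtain ⟨a, ha, ha0⟩ := Submodule.exists_mem_ne_zero_of_ne_bot hI0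
    refine Submodule.ne_bot_iff _ |>.2 ⟨algebraMap R _ a, Ideal.mem_map_of_mem _ ?_, ?_⟩
    · exact pow_le_symbolicPower _ 1 (by rwa [pow_one])
    · rwa [Ne, map_eq_zero_iff _ (hinj Q)]
  refine ⟨fun Q _ hIQ hQ => ?_, fun i => ⟨?_, ?_⟩⟩
  · obtain ⟨j, hj⟩ := exists_le_of_iInf_le P hIQ
    have hass := mem_associatedPrimes_iInf P hheight j
    -- `P j ≤ Q ≤ P i` with equal heights would force `Q = P i`.
    have hnot : ∀ i, ¬ Q ≤ P i := fun i hi => hQ i (le_antisymm hi (by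
      rw [← (P j).eq_of_le_of_height_le (hj.trans hi) (by rw [hheight, hheight])]
      exact hj))
    obtain ⟨y, hyQ, hy⟩ : ∃ y ∈ Q, ∀ i, y ∉ P i := by
      by_contra! hcon
      have hsub : (Q : Set R) ⊆ ⋃ i ∈ ((Finset.univ : Finset (Fin r)) : Set (Fin r)), P i := by
        intro y hy
        obtain ⟨i, hi⟩ := hcon y hy
        simpa using ⟨i, hi⟩
      obtain ⟨i, -, hi⟩ := (Ideal.subset_union_prime j j fun i _ _ _ => inferInstance).1 hsub
      exact hnot i hi
    rw [← Localization.AtPrime.height_maximalIdeal Q]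
    refine IdealFiltration.analyticSpread_lt _ (hne Q j) ?_ (algebraMap R _ y) ?_ ?_
    · rw [← Localization.AtPrime.map_eq_maximalIdeal]
      exact Ideal.map_mono ((symbolicPower_one_le hass (iInf_le P j)).trans hj)
    · rw [← Localization.AtPrime.map_eq_maximalIdeal]
      exact Ideal.mem_map_of_mem _ hyQ
    -- Regularity of `y` modulo the symbolic powers passes to `R_Q` by clearing denominators.
    · intro n s' hs'
      obtain ⟨s, u, rfl⟩ := IsLocalization.exists_mk'_eq Q.primeCompl s'
      change _ ∈ (symbolicPower _ n).map _ at hs'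
      change _ ∈ (symbolicPower _ n).map _
      rw [IsLocalization.mul_mk'_eq_mk'_of_mul,
        IsLocalization.mk'_mem_map_algebraMap_iff Q.primeCompl] at hs'
      rw [IsLocalization.mk'_mem_map_algebraMap_iff Q.primeCompl]
      obtain ⟨v, hv, hvs⟩ := hs'
      refine ⟨v, hv, mem_symbolicPower_of_mul_mem (x := y) (fun p hp => ?_) ?_⟩
      · obtain ⟨i, rfl⟩ := exists_eq_of_mem_associatedPrimes_iInf P hp
        exact hy i
      · rwa [mul_left_comm]
  · rw [← Localization.AtPrime.height_maximalIdeal (P i)]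
    have hm : IsLocalRing.maximalIdeal (Localization.AtPrime (P i)) ≠ ⊥ := by
      rw [Ne, ← Ideal.height_eq_zero_iff_eq_bot, Localization.AtPrime.height_maximalIdeal, hheight]
      exact_mod_cast hpos.ne'
    refine le_antisymm (IdealFiltration.analyticSpread_le _ (hne (P i) i) hm)
      (IdealFiltration.le_analyticSpread_of_eq_pow _ fun n => le_antisymm ?_ ?_)
    · exact map_symbolicPower_le (mem_associatedPrimes_iInf P hheight i) (iInf_le P i) n
    · rw [← map_iInf_eq_maximalIdeal P hheight i, ← Ideal.map_pow]
      exact Ideal.map_mono (pow_le_symbolicPower _ n)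
  · rw [hheight, height_iInf_eq P hheight i]
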